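/- Let $E$ be a finite set with $n$ elements. Let $\mathcal M^1=(E,\mathcal I^1)$ and $\mathcal M^2=(E,\mathcal I^2)$ (the *clean* matroids) be partition matroids: for each of them, $E$ is partitioned into classes $C$ with capacities $k_C\in\mathbb Z_{\ge 0}$, and a set $S\subseteq E$ is independent if and only if $|C\cap S|\le k_C$ for every class $C$. Let $\mathcal M^1_d=(E,\mathcal I^1_d)$ and $\mathcal M^2_d=(E,\mathcal I^2_d)$ (the *dirty* matroids) be matroids with $\mathcal I^1\subseteq\mathcal I^1_d$ and $\mathcal I^2\subseteq\mathcal I^2_d$. Put $\eta_i=|\mathcal I^i_d\setminus\mathcal I^i|$ for $i=1,2$, and let $r$ be the minimum of the ranks of $\mathcal M^1$ and $\mathcal M^2$. We consider deterministic adaptive algorithms (decision trees) that know $E$ and access the four matroids only through independence oracles; the algorithm does not depend on the matroids (nor on their classes and capacities, nor on $\eta_1,\eta_2,r$). Only calls to the independence oracles of the clean matroids are counted. We set $\lceil\log_2 0\rceil:=0$. 1. There is an algorithm that, given in addition a set $X\in\mathcal I^1\cap\mathcal I^2$, either returns a set in $\mathcal I^1\cap\mathcal I^2$ of cardinality $|X|+1$,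 or correctly reports that $X$ has maximum cardinality in $\mathcal I^1\cap\mathcal I^2$, and that uses at most $2+(\eta_1+\eta_2)(\lceil\log_2 n\rceil+2)$ clean-oracle calls. 2. There is an algorithm that computes a set of maximum cardinality in $\mathcal I^1\cap\mathcal I^2$ using at most $(r+1)\bigl(2+(\eta_1+\eta_2)(\lceil\log_2 n\rceil+2)\bigr)$ clean-oracle calls. -/

import Mathlib

/-- A matroid on the finite ground set `E` is a *partition matroid* if the elements of `E` are
partitioned into classes `C` with capacities `k C` and a set is independent if and only if
it contains at most `k C` elements of each class `C`. -/
def IsPartitionMatroid {E : Type*} [Fintype E] [DecidableEq E] (M : Matroid E) : Prop :=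
  M.E = Set.univ ∧
    ∃ (P : Finpartition (Finset.univ : Finset E)) (k : Finset E → ℕ),
      ∀ S : Finset E, M.Indep (S : Set E) ↔ ∀ C ∈ P.parts, (C ∩ S).card ≤ k C

/-- Deterministic adaptive algorithms in the two-oracle model for a pair of matroids on `E`, as
decision trees. A node is either a final output, or an independence query "is `F` independent in
matroid number `i`?" to the dirty or to the clean oracle, followed by a continuation that
depends on the answer. The tree itself knows neither the clean nor the dirty matroids: it learns
about them only through the answers. -/
inductive TwoOracleAlg (E : Type*) (β : Type*) where
  | output (b : β) : TwoOracleAlg E β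
  | dirtyQuery (i : Fin 2) (F : Finset E) (next : Bool → TwoOracleAlg E β) : TwoOracleAlg E β
  | cleanQuery (i : Fin 2) (F : Finset E) (next : Bool → TwoOracleAlg E β) : TwoOracleAlg E β

namespace TwoOracleAlg

open Classical in
/-- The output of an algorithm on the instance with clean matroids `M 0, M 1` and dirty matroids
`Md 0, Md 1`. -/
noncomputable def run {E β : Type*} (M Md : Fin 2 → Matroid E) : TwoOracleAlg E β → β
  | output b => b
  | dirtyQuery i F next => run M Md (next (decide ((Md i).Indep (F : Set E))))
  | cleanQuery i F next => run M Md (next (decide ((M i).Indep (F : Set E))))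

open Classical in
/-- The number of clean-oracle calls of an algorithm on the instance with clean matroids
`M 0, M 1` and dirty matroids `Md 0, Md 1`; dirty-oracle calls are free. -/
noncomputable def cleanCalls {E β : Type*} (M Md : Fin 2 → Matroid E) : TwoOracleAlg E β → ℕ
  | output _ => 0
  | dirtyQuery i F next => cleanCalls M Md (next (decide ((Md i).Indep (F : Set E))))
  | cleanQuery i F next => cleanCalls M Md (next (decide ((M i).Indep (F : Set E)))) + 1

end TwoOracleAlg

/-- Feasible solutions of the matroid intersection problem. -/
def CommonIndep {E : Type*} (M : Fin 2 → Matroid E) (X : Finset E) : Prop :=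
  ∀ i, (M i).Indep (X : Set E)

/-- Optimum solutions of the matroid intersection problem. -/
def IsMaxCommonIndep {E : Type*} (M : Fin 2 → Matroid E) (X : Finset E) : Prop :=
  CommonIndep M X ∧ ∀ Y : Finset E, CommonIndep M Y → Y.card ≤ X.card

/-- An instance: the clean matroids are partition matroids on `E`, and the dirty matroids are
matroids on `E` in which every set that is independent in the clean matroid is independent. -/
structure IsInstance {E : Type*} [Fintype E] [DecidableEq E] (M Md : Fin 2 → Matroid E) :
    Prop where
  partition : ∀ i, IsPartitionMatroid (M i)
  dirty_ground : ∀ i, (Md i).E = Set.univ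
  superset : ∀ i (F : Finset E), (M i).Indep (F : Set E) → (Md i).Indep (F : Set E)

/-- The error of matroid number `i`: the number of sets that are independent in the dirty
matroid but not in the clean one. -/
noncomputable def eta {E : Type*} (M Md : Fin 2 → Matroid E) (i : Fin 2) : ℕ :=
  {F : Finset E | (Md i).Indep (F : Set E) ∧ ¬ (M i).Indep (F : Set E)}.ncard

/-- The smaller one of the ranks of the two clean matroids. -/
noncomputable def minRank {E : Type*} (M : Fin 2 → Matroid E) : ℕ :=
  min (M 0).eRank.toNat (M 1).eRank.toNat

/-- The bound `2 + (η₁ + η₂) (⌈log₂ n⌉ + 2)` where `n` is the number of elements of `E`. -/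
noncomputable def stepBound {E : Type*} [Fintype E] (M Md : Fin 2 → Matroid E) : ℕ :=
  2 + (eta M Md 0 + eta M Md 1) * (⌈Real.logb 2 (Fintype.card E)⌉₊ + 2)

/-! Dirty queries are free, so the dirty families may be treated as known. Let `K` collect the
errors found so far: pairs `(i, F)` with `F` independent in the dirty but not in the clean matroid
`i`. Deleting `K` from the dirty families leaves families `J i` that still contain the clean ones,
so the exchange graph of `J` at `X` contains the clean one. If it has no path from a source to a
sink, `X` is maximum (`isMaxCommonIndep_of_not_reachIn`).

Otherwise, two clean calls test the result `Z` of exchanging along a shortest path. If `Z` is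
dependent in matroid `i`, the partial exchanges lead from the independent `X` to a dependent set,
and binary search finds an arc at which independence is lost. In a partition matroid such exchanges
are swaps within one class and remain valid after other exchanges, so this arc is not a clean one
(`IsArcSeq.not_indep_arcSet`): its set is a new error. Each of the at most `η₁ + η₂` errors costs
`⌈log₂ n⌉ + 2` calls, and the final round at most 2.

Iterating from `∅` gives at most `r` augmentations and one final report of optimality. -/

namespace TwoOracleAlg

/-! ### Decision trees: composition, free dirty queries, binary search -/

variable {E β γ : Type*}

/-- Run an algorithm and continue with an algorithm depending on its output. -/
def bind : TwoOracleAlg E β → (β → TwoOracleAlg E γ) → TwoOracleAlg E γ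
  | output b, g => g b
  | dirtyQuery i F next, g => dirtyQuery i F fun b => (next b).bind g
  | cleanQuery i F next, g => cleanQuery i F fun b => (next b).bind g

theorem run_bind (M Md : Fin 2 → Matroid E) (a : TwoOracleAlg E β) (g : β → TwoOracleAlg E γ) :
    (a.bind g).run M Md = (g (a.run M Md)).run M Md := by
  induction a with
  | output b => rfl
  | dirtyQuery i F next ih => simp only [bind, run, ih]
  | cleanQuery i F next ih => simp only [bind, run, ih]

theorem cleanCalls_bind (M Md : Fin 2 → Matroid E) (a : TwoOracleAlg E β)
    (g : β → TwoOracleAlg E γ) :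
    (a.bind g).cleanCalls M Md =
      a.cleanCalls M Md + (g (a.run M Md)).cleanCalls M Md := by
  induction a with
  | output b => simp [bind, run, cleanCalls]
  | dirtyQuery i F next ih => simp only [bind, run, cleanCalls, ih]
  | cleanQuery i F next ih => simp only [bind, run, cleanCalls, ih]; omega

/-- As dirty queries are free, an algorithm may depend on the dirty matroids. -/
theorem exists_alg_of_forall_dirty [Fintype E]
    (Q : (Fin 2 → Matroid E) → (Fin 2 → Matroid E) → β → ℕ → Prop)
    (h : ∀ D : Fin 2 × Finset E → Prop, ∃ a : TwoOracleAlg E β, ∀ M Md : Fin 2 → Matroid E,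
      (∀ q, D q ↔ (Md q.1).Indep (q.2 : Set E)) → Q M Md (a.run M Md) (a.cleanCalls M Md)) :
    ∃ a : TwoOracleAlg E β, ∀ M Md : Fin 2 → Matroid E,
      Q M Md (a.run M Md) (a.cleanCalls M Md) := by
  classical
  -- `A` holds the queries not yet asked; the values of `D` on `A` are irrelevant, and each answer
  -- is recorded in `D`.
  suffices H : ∀ A : Finset (Fin 2 × Finset E), ∀ D : Fin 2 × Finset E → Prop,
      ∃ a : TwoOracleAlg E β, ∀ M Md : Fin 2 → Matroid E,
        (∀ q, q ∉ A → (D q ↔ (Md q.1).Indep (q.2 : Set E))) →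
          Q M Md (a.run M Md) (a.cleanCalls M Md) by
    obtain ⟨a, ha⟩ := H Finset.univ fun _ => True
    exact ⟨a, fun M Md => ha M Md fun q hq => absurd (Finset.mem_univ q) hq⟩
  intro A
  induction A using Finset.induction_on with
  | empty =>
    intro D
    obtain ⟨a, ha⟩ := h D
    exact ⟨a, fun M Md hD => ha M Md fun q => hD q (Finset.notMem_empty q)⟩
  | insert p A _ ih =>
    intro D
    choose a ha using fun b : Bool => ih (Function.update D p (b = true))
    refine ⟨dirtyQuery p.1 p.2 a, fun M Md hD => ha _ M Md fun q hq => ?_⟩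
    by_cases hqp : q = p
    · subst hqp; simp
    · rw [Function.update_of_ne hqp]
      exact hD q (by simp [hqp, hq])

/-- Binary search for a place where a sequence of sets turns from independent to dependent. -/
theorem exists_binary_search (i : Fin 2) (Z : ℕ → Finset E) (g : ℕ → TwoOracleAlg E β) (p : ℕ) :
    ∀ lo d : ℕ, d ≤ 2 ^ p → ∃ a : TwoOracleAlg E β, ∀ M Md : Fin 2 → Matroid E,
      (M i).Indep (Z lo : Set E) → ¬ (M i).Indep (Z (lo + d) : Set E) →
      ∃ m, lo ≤ m ∧ m < lo + d ∧ (M i).Indep (Z m : Set E) ∧ ¬ (M i).Indep (Z (m + 1) : Set E) ∧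
        a.run M Md = (g m).run M Md ∧ a.cleanCalls M Md ≤ (g m).cleanCalls M Md + p := by
  induction p with
  | zero =>
    intro lo d hd
    refine ⟨g lo, fun M Md h0 h1 => ?_⟩
    obtain rfl | rfl : d = 0 ∨ d = 1 := by simp at hd; omega
    · exact absurd h0 h1
    · exact ⟨lo, le_rfl, by omega, h0, h1, rfl, by omega⟩
  | succ p ih =>
    intro lo d hd
    rw [pow_succ] at hd
    obtain ⟨a, ha⟩ := ih lo (d / 2) (by omega)
    obtain ⟨b, hb⟩ := ih (lo + d / 2) (d - d / 2) (by omega)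
    refine ⟨cleanQuery i (Z (lo + d / 2)) fun t => if t then b else a, fun M Md h0 h1 => ?_⟩
    by_cases hmid : (M i).Indep (Z (lo + d / 2) : Set E)
    · obtain ⟨m, h2, h3, h4, h5, h6, h7⟩ := hb M Md hmid
        (by rwa [show lo + d / 2 + (d - d / 2) = lo + d by omega])
      refine ⟨m, by omega, by omega, h4, h5, by simpa [run, hmid] using h6, ?_⟩
      simp only [cleanCalls, hmid, decide_true, if_true]
      omega
    · obtain ⟨m, h2, h3, h4, h5, h6, h7⟩ := ha M Md h0 hmid
      refine ⟨m, by omega, by omega, h4, h5, by simpa [run, hmid] using h6, ?_⟩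
      simp only [cleanCalls, hmid, decide_false, Bool.false_eq_true, if_false]
      omega

end TwoOracleAlg

/-! ### Exchange properties of partition matroids -/

section Partition

variable {E : Type*} [DecidableEq E] {M : Matroid E}

theorem IsPartitionMatroid.exists_label [Fintype E] (h : IsPartitionMatroid M) :
    ∃ (f : E → Finset E) (k : Finset E → ℕ), ∀ S : Finset E,
      M.Indep (S : Set E) ↔ ∀ c, (S.filter fun s => f s = c).card ≤ k c := by
  obtain ⟨_, P, k, hk⟩ := h
  have key : ∀ C ∈ P.parts, ∀ S : Finset E, C ∩ S = S.filter fun s => P.part s = C := by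
    intro C hC S
    ext s
    simp only [Finset.mem_inter, Finset.mem_filter]
    rw [P.part_eq_iff_mem hC, and_comm]
  refine ⟨P.part, k, fun S => ?_⟩
  rw [hk]
  refine ⟨fun h c => ?_, fun h C hC => by rw [key C hC]; exact h C⟩
  by_cases hc : c ∈ P.parts
  · rw [← key c hc]; exact h c hc
  · rw [Finset.filter_false_of_mem, Finset.card_empty]
    · exact Nat.zero_le _
    · rintro s _ rfl
      exact hc (P.part_mem.2 (Finset.mem_univ s))

variable {f : E → Finset E} {k : Finset E → ℕ}

theorem indep_exchange_of_label_eq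
    (hM : ∀ S : Finset E, M.Indep (S : Set E) ↔ ∀ c, (S.filter fun s => f s = c).card ≤ k c)
    {Z : Finset E} {u w : E} (hZ : M.Indep (Z : Set E)) (hw : w ∈ Z) (h : f w = f u) :
    M.Indep (insert u (Z.erase w) : Finset E) := by
  rw [hM] at hZ ⊢
  intro c
  refine le_trans ?_ (hZ c)
  rw [Finset.filter_insert, Finset.filter_erase]
  split_ifs with hc
  · have hwm : w ∈ Z.filter fun s => f s = c := by simp [hw, h, hc]
    have := Finset.card_erase_add_one hwm
    have := Finset.card_insert_le u ((Z.filter fun s => f s = c).erase w)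
    omega
  · exact Finset.card_le_card (Finset.erase_subset _ _)

theorem capacity_le_of_not_indep_insert
    (hM : ∀ S : Finset E, M.Indep (S : Set E) ↔ ∀ c, (S.filter fun s => f s = c).card ≤ k c)
    {X : Finset E} {u : E} (hX : M.Indep (X : Set E))
    (hu : ¬ M.Indep (insert u X : Finset E)) :
    k (f u) ≤ (X.filter fun s => f s = f u).card := by
  rw [hM] at hX hu
  push Not at hu
  obtain ⟨c, hc⟩ := hu
  rw [Finset.filter_insert] at hc
  split_ifs at hc with h
  · subst h
    have := Finset.card_insert_le u (X.filter fun s => f s = f u)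
    omega
  · exact absurd (hX c) (by omega)

/-- In a partition matroid, an exchange at an element that cannot simply be added stays possible
in every independent set. -/
theorem IsPartitionMatroid.indep_exchange [Fintype E] (h : IsPartitionMatroid M) {X Z : Finset E} {u w : E}
    (hX : M.Indep (X : Set E)) (huX : u ∉ X) (hu : ¬ M.Indep (insert u X : Finset E))
    (huw : M.Indep (insert u (X.erase w) : Finset E))
    (hZ : M.Indep (Z : Set E)) (hw : w ∈ Z) :
    M.Indep (insert u (Z.erase w) : Finset E) := by
  obtain ⟨f, k, hM⟩ := h.exists_label
  refine indep_exchange_of_label_eq hM hZ hw ?_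
  -- The class of `u` is full in `X`. Removing a `w` of another class would leave it full, and
  -- adding `u` would overfill it.
  by_contra hne
  have h1 := capacity_le_of_not_indep_insert hM hX hu
  have h2 := (hM _).1 huw (f u)
  rw [Finset.filter_insert, if_pos rfl, Finset.filter_erase,
    Finset.erase_eq_of_notMem (by simp [hne]), Finset.card_insert_of_notMem (by simp [huX])] at h2
  omega

/-- Some class has more elements in `Y ∩ T` than in `X ∩ T`, which supplies `y`. If `y` cannot be
added, `X` fills this class, so it has at least as many elements there as `Y`; one of them must lie
outside `T` and can be swapped for `y`. -/
theorem IsPartitionMatroid.exists_exchange_of_card_lt [Fintype E] (h : IsPartitionMatroid M)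
    {X Y T : Finset E} (hX : M.Indep (X : Set E)) (hY : M.Indep (Y : Set E))
    (hlt : (X ∩ T).card < (Y ∩ T).card) :
    ∃ y ∈ T, y ∉ X ∧ (M.Indep (insert y X : Finset E) ∨
      ∃ x ∈ X, x ∉ T ∧ M.Indep (insert y (X.erase x) : Finset E)) := by
  obtain ⟨f, k, hM⟩ := h.exists_label
  obtain ⟨c, hc⟩ : ∃ c, ((X ∩ T).filter fun s => f s = c).card <
      ((Y ∩ T).filter fun s => f s = c).card := by
    by_contra! hcon
    have e : ∀ S : Finset E, S.card = ∑ c, (S.filter fun s => f s = c).card := fun S =>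
      Finset.card_eq_sum_card_fiberwise fun s _ => Finset.mem_coe.2 (Finset.mem_univ (f s))
    rw [e (X ∩ T), e (Y ∩ T)] at hlt
    exact absurd (Finset.sum_le_sum fun c _ => hcon c) (not_le.2 hlt)
  obtain ⟨y, hy, hyX⟩ := Finset.exists_mem_notMem_of_card_lt_card hc
  simp only [Finset.mem_filter, Finset.mem_inter] at hy hyX
  obtain ⟨⟨hyY, hyT⟩, rfl⟩ := hy
  refine ⟨y, hyT, fun hyX' => hyX ⟨⟨hyX', hyT⟩, rfl⟩, ?_⟩
  by_contra! hcon
  have h1 := capacity_le_of_not_indep_insert hM hX hcon.1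
  have h2 := (hM Y).1 hY (f y)
  have h3 : ((Y ∩ T).filter fun s => f s = f y).card ≤ (Y.filter fun s => f s = f y).card :=
    Finset.card_le_card (Finset.filter_subset_filter _ Finset.inter_subset_left)
  obtain ⟨x, hx, hxT⟩ := Finset.exists_mem_notMem_of_card_lt_card (hc.trans_le (h3.trans (h2.trans h1)))
  simp only [Finset.mem_filter, Finset.mem_inter] at hx hxT
  exact hcon.2 x hx.1 (fun hT => hxT ⟨⟨hx.1, hT⟩, hx.2⟩)
    (indep_exchange_of_label_eq hM hX hx.1 hx.2)

end Partition

/-! ### The exchange graph and shortest augmenting paths -/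

section ExchangeGraph

variable {E : Type*} [DecidableEq E]

/-- The elements outside `X` that are reached from a source of the exchange graph of the set
families `J 0, J 1` at `X` by a walk through `t` elements of `X`. -/
def ReachIn (J : Fin 2 → Finset E → Prop) (X : Finset E) : ℕ → E → Prop
  | 0, y => y ∉ X ∧ J 0 (insert y X)
  | t + 1, y => y ∉ X ∧ ∃ z, ReachIn J X t z ∧
      ∃ x ∈ X, J 1 (insert z (X.erase x)) ∧ J 0 (insert y (X.erase x))

variable {J : Fin 2 → Finset E → Prop} {X : Finset E}

theorem ReachIn.notMem {t : ℕ} {y : E} (h : ReachIn J X t y) : y ∉ X := by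
  cases t <;> exact h.1

/-- If no sink is reachable in a supergraph of the exchange graph, then `X` is optimal. -/
theorem isMaxCommonIndep_of_not_reachIn [Fintype E] {M : Fin 2 → Matroid E}
    (hM : ∀ i, IsPartitionMatroid (M i)) (hX : CommonIndep M X)
    (hJ : ∀ i (F : Finset E), (M i).Indep (F : Set E) → J i F)
    (hno : ∀ t y, ReachIn J X t y → ¬ J 1 (insert y X)) : IsMaxCommonIndep M X := by
  classical
  refine ⟨hX, fun Y hY => ?_⟩
  by_contra! hlt
  -- `T` is the set of reachable vertices. A larger `Y` beats `X` on `T` or on its complement;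
  -- matroid 1 then gives a sink in `T` or an arc leaving `T`, matroid 0 a source outside `T` or an
  -- arc leaving `T`.
  let T : Finset E := Finset.univ.filter fun v => (∃ t, ReachIn J X t v) ∨
    v ∈ X ∧ ∃ t z, ReachIn J X t z ∧ J 1 (insert z (X.erase v))
  have hT : ∀ v, v ∈ T ↔ (∃ t, ReachIn J X t v) ∨
    v ∈ X ∧ ∃ t z, ReachIn J X t z ∧ J 1 (insert z (X.erase v)) := fun v => by simp [T]
  have eX := Finset.card_inter_add_card_sdiff X T
  have eY := Finset.card_inter_add_card_sdiff Y T
  rw [Finset.sdiff_eq_inter_compl] at eX eY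
  rcases lt_or_ge (X ∩ T).card (Y ∩ T).card with h | h
  · obtain ⟨y, hyT, hyX, hy⟩ := (hM 1).exists_exchange_of_card_lt (hX 1) (hY 1) h
    obtain ⟨t, ht⟩ | h' := (hT y).1 hyT
    · rcases hy with hy | ⟨x, hxX, hxT, hx⟩
      · exact hno t y ht (hJ 1 _ hy)
      · exact hxT ((hT x).2 (Or.inr ⟨hxX, t, y, ht, hJ 1 _ hx⟩))
    · exact hyX h'.1
  · obtain ⟨y, hyT, hyX, hy⟩ := (hM 0).exists_exchange_of_card_lt (T := Tᶜ) (hX 0) (hY 0)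
      (by omega)
    rw [Finset.mem_compl] at hyT
    rcases hy with hy | ⟨x, hxX, hxT, hx⟩
    · exact hyT ((hT y).2 (Or.inl ⟨0, hyX, hJ 0 _ hy⟩))
    · rw [Finset.mem_compl, not_not] at hxT
      obtain ⟨t, ht⟩ | ⟨_, t, z, ht, hz⟩ := (hT x).1 hxT
      · exact ht.notMem hxX
      · exact hyT ((hT y).2 (Or.inl ⟨t + 1, hyX, z, ht, x, hxX, hz, hJ 0 _ hx⟩))

/-- The exchange along the first `m` arcs of a sequence of arcs: first `u 0` is added, then each
`w j` is replaced with `u (j + 1)`. -/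
def prefixExchange (X : Finset E) (u w : ℕ → E) (m : ℕ) : Finset E :=
  X \ (Finset.range (m - 1)).image w ∪ (Finset.range m).image u

/-- The set that witnesses the arc number `m`. -/
def arcSet (X : Finset E) (u w : ℕ → E) : ℕ → Finset E
  | 0 => insert (u 0) X
  | j + 1 => insert (u (j + 1)) (X.erase (w j))

/-- A sequence of `k + 1` arcs of the exchange graph of a single family `J` at `X`, as they arise
from a path without shortcuts. -/
structure IsArcSeq (J : Finset E → Prop) (X : Finset E) (k : ℕ) (u w : ℕ → E) : Prop where
  notMem : ∀ j ≤ k, u j ∉ X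
  mem : ∀ j < k, w j ∈ X
  inj_u : ∀ i j, i < j → j ≤ k → u i ≠ u j
  inj_w : ∀ i j, i < j → j < k → w i ≠ w j
  arc : ∀ m ≤ k, J (arcSet X u w m)
  not_insert : ∀ j < k, ¬ J (insert (u (j + 1)) X)

variable {J' : Finset E → Prop} {k : ℕ} {u w : ℕ → E}

theorem IsArcSeq.card_prefixExchange (h : IsArcSeq J' X k u w) :
    (prefixExchange X u w (k + 1)).card = X.card + 1 := by
  have hu : Set.InjOn u (Finset.range (k + 1)) := by
    intro i hi j hj hij
    simp only [Finset.coe_range, Set.mem_Iio] at hi hj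
    rcases lt_trichotomy i j with hlt | heq | hlt
    · exact absurd hij (h.inj_u i j hlt (by omega))
    · exact heq
    · exact absurd hij.symm (h.inj_u j i hlt (by omega))
  have hw : Set.InjOn w (Finset.range k) := by
    intro i hi j hj hij
    simp only [Finset.coe_range, Set.mem_Iio] at hi hj
    rcases lt_trichotomy i j with hlt | heq | hlt
    · exact absurd hij (h.inj_w i j hlt (by omega))
    · exact heq
    · exact absurd hij.symm (h.inj_w j i hlt (by omega))
  have hsub : (Finset.range k).image w ⊆ X := by
    intro x hx
    obtain ⟨j, hj, rfl⟩ := Finset.mem_image.1 hx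
    exact h.mem j (Finset.mem_range.1 hj)
  have hdisj : Disjoint (X \ (Finset.range k).image w) ((Finset.range (k + 1)).image u) := by
    rw [Finset.disjoint_left]
    intro x hx hx'
    obtain ⟨j, hj, rfl⟩ := Finset.mem_image.1 hx'
    exact h.notMem j (by simpa [Nat.lt_succ_iff] using hj) (Finset.mem_sdiff.1 hx).1
  have hle := Finset.card_le_card hsub
  rw [prefixExchange, Nat.add_sub_cancel, Finset.card_union_of_disjoint hdisj,
    Finset.card_sdiff_of_subset hsub, Finset.card_image_of_injOn hu]
  rw [Finset.card_image_of_injOn hw, Finset.card_range] at hle ⊢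
  rw [Finset.card_range]
  omega

theorem IsArcSeq.length_le [Fintype E] (h : IsArcSeq J' X k u w) : k + 1 ≤ Fintype.card E := by
  by_contra! hlt
  have : Function.Injective fun j : Fin (k + 1) => u j := by
    intro i j hij
    rcases lt_trichotomy i j with hl | heq | hl
    · exact absurd hij (h.inj_u i j hl (by omega))
    · exact heq
    · exact absurd hij.symm (h.inj_u j i hl (by omega))
  have := Fintype.card_le_of_injective _ this
  simp at this
  omega

/-- The arc at which the prefix exchanges become dependent is not an arc of the clean exchange
graph. -/
theorem IsArcSeq.not_indep_arcSet [Fintype E] {M : Matroid E} (hM : IsPartitionMatroid M)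
    (h : IsArcSeq J' X k u w) (hX : M.Indep (X : Set E))
    (hJ : ∀ F : Finset E, M.Indep (F : Set E) → J' F) {m : ℕ} (hm : m ≤ k)
    (h0 : M.Indep (prefixExchange X u w m : Set E))
    (h1 : ¬ M.Indep (prefixExchange X u w (m + 1) : Set E)) :
    ¬ M.Indep (arcSet X u w m : Set E) := by
  intro harc
  apply h1
  cases m with
  | zero =>
    convert harc using 2
    simp [prefixExchange, arcSet]
  | succ j =>
    have hwZ : w j ∈ prefixExchange X u w (j + 1) := by
      simp only [prefixExchange, Nat.add_sub_cancel, Finset.mem_union, Finset.mem_sdiff,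
        Finset.mem_image, Finset.mem_range, not_exists, not_and]
      exact Or.inl ⟨h.mem j hm, fun i hi => h.inj_w i j hi hm⟩
    -- Since `u (j + 1)` cannot be added to `X` even in the larger family `J'`, its class is full in
    -- `X`, so the swap carries over from `X` to the prefix exchange.
    have := hM.indep_exchange hX (h.notMem (j + 1) hm) (fun hi => h.not_insert j hm (hJ _ hi)) harc h0 hwZ
    convert this using 2
    ext v
    simp only [prefixExchange, Nat.add_sub_cancel, Finset.mem_union, Finset.mem_sdiff,
      Finset.mem_image, Finset.mem_range, Finset.mem_insert, Finset.mem_erase, not_exists, not_and]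
    have hne : ∀ i, i < j + 1 → u i ≠ w j := fun i hi he =>
      h.notMem i (by omega) (he ▸ h.mem j hm)
    constructor
    · rintro (⟨hv, hvw⟩ | ⟨i, hi, rfl⟩)
      · exact Or.inr ⟨fun e => hvw j (by omega) e.symm,
          Or.inl ⟨hv, fun i hi => hvw i (by omega)⟩⟩
      · obtain hi | rfl : i < j + 1 ∨ i = j + 1 := by omega
        · exact Or.inr ⟨hne i hi, Or.inr ⟨i, hi, rfl⟩⟩
        · exact Or.inl rfl
    · rintro (rfl | ⟨hvj, ⟨hv, hvw⟩ | ⟨i, hi, rfl⟩⟩)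
      · exact Or.inr ⟨j + 1, by omega, rfl⟩
      · refine Or.inl ⟨hv, fun i hi => ?_⟩
        obtain hi | rfl : i < j ∨ i = j := by omega
        · exact hvw i hi
        · exact fun e => hvj e.symm
      · exact Or.inr ⟨i, by omega, rfl⟩

/-- A shortest walk to `y` in the exchange graph. -/
theorem exists_shortest_walk : ∀ (t : ℕ) (y : E), ReachIn J X t y →
    (∀ s < t, ¬ ReachIn J X s y) → ∃ u w : ℕ → E, u t = y ∧
      (∀ j ≤ t, ReachIn J X j (u j) ∧ ∀ s < j, ¬ ReachIn J X s (u j)) ∧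
      ∀ j < t, w j ∈ X ∧ J 1 (insert (u j) (X.erase (w j))) ∧
        J 0 (insert (u (j + 1)) (X.erase (w j))) := by
  intro t
  induction t with
  | zero =>
    intro y hy _
    refine ⟨fun _ => y, fun _ => y, rfl, fun j hj => ?_, by omega⟩
    obtain rfl : j = 0 := by omega
    exact ⟨hy, by omega⟩
  | succ t ih =>
    intro y hy hmin
    obtain ⟨hyX, z, hz, x, hx, hx1, hx0⟩ := id hy
    obtain ⟨u, w, hut, hu, hw⟩ := ih z hz fun s hs hsz =>
      hmin (s + 1) (by omega) ⟨hyX, z, hsz, x, hx, hx1, hx0⟩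
    refine ⟨Function.update u (t + 1) y, Function.update w t x, by simp, fun j hj => ?_,
      fun j hj => ?_⟩
    · rcases Nat.lt_or_ge j (t + 1) with hlt | hge
      · rw [Function.update_of_ne (by omega)]
        exact hu j (by omega)
      · obtain rfl : j = t + 1 := by omega
        rw [Function.update_self]
        exact ⟨hy, hmin⟩
    · rw [Function.update_of_ne (show j ≠ t + 1 by omega)]
      rcases Nat.lt_or_ge j t with hlt | hge
      · rw [Function.update_of_ne (show j ≠ t by omega),
          Function.update_of_ne (show j + 1 ≠ t + 1 by omega)]
        exact hw j hlt
      · obtain rfl : j = t := by omega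
        rw [Function.update_self, Function.update_self, hut]
        exact ⟨hx, hx1, hx0⟩

/-- A reachable sink yields arc sequences for both families that describe the same exchange. -/
theorem exists_isArcSeq (h : ∃ t y, ReachIn J X t y ∧ J 1 (insert y X)) :
    ∃ (k : ℕ) (u w : Fin 2 → ℕ → E), (∀ i, IsArcSeq (J i) X k (u i) (w i)) ∧
      prefixExchange X (u 0) (w 0) (k + 1) = prefixExchange X (u 1) (w 1) (k + 1) := by
  classical
  obtain ⟨y, hy, hsink⟩ := Nat.find_spec h
  have hfirst : ∀ s < Nat.find h, ∀ z, ReachIn J X s z → ¬ J 1 (insert z X) :=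
    fun s hs z hz hz1 => Nat.find_min h hs ⟨z, hz, hz1⟩
  generalize Nat.find h = k at hy hfirst
  obtain ⟨u, w, rfl, hu, hw⟩ := exists_shortest_walk k y hy fun s hs hsy => hfirst s hs y hsy hsink
  have inj_u : ∀ i j, i < j → j ≤ k → u i ≠ u j := fun i j hij hj he =>
    (hu j hj).2 i hij (he ▸ (hu i (by omega)).1)
  -- A repeated `w` would be a shortcut from `u i` directly to `u (j + 1)`.
  have inj_w : ∀ i j, i < j → j < k → w i ≠ w j := fun i j hij hj he =>
    (hu (j + 1) hj).2 (i + 1) (by omega) ⟨(hu (j + 1) hj).1.notMem, u i, (hu i (by omega)).1, w i,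
      (hw i (by omega)).1, (hw i (by omega)).2.1, he ▸ (hw j hj).2.2⟩
  -- Matroid 1 reads the path backwards from the sink. Minimality excludes later sources for matroid
  -- 0 and earlier sinks for matroid 1.
  refine ⟨k, ![u, fun j => u (k - j)], ![w, fun j => w (k - 1 - j)], ?_, ?_⟩
  · rw [Fin.forall_fin_two]
    constructor
    · refine ⟨fun j hj => (hu j hj).1.notMem, fun j hj => (hw j hj).1, inj_u, inj_w, ?_,
        fun j hj hJ => (hu (j + 1) hj).2 0 (by omega) ⟨(hu (j + 1) hj).1.notMem, hJ⟩⟩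
      rintro (_ | j) hj
      · exact (hu 0 hj).1.2
      · exact (hw j hj).2.2
    · refine ⟨fun j hj => (hu (k - j) (by omega)).1.notMem,
        fun j hj => (hw (k - 1 - j) (by omega)).1,
        fun i j hij hj => (inj_u (k - j) (k - i) (by omega) (by omega)).symm,
        fun i j hij hj => (inj_w (k - 1 - j) (k - 1 - i) (by omega) (by omega)).symm, ?_,
        fun j hj => hfirst (k - (j + 1)) (by omega) _ (hu _ (by omega)).1⟩
      rintro (_ | j) hj
      · exact hsink
      · have := (hw (k - 1 - j) (by omega)).2.1
        simpa [arcSet, show k - (j + 1) = k - 1 - j by omega] using this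
  · have e : ∀ (v : ℕ → E) (n : ℕ),
        (Finset.range n).image (fun j => v (n - 1 - j)) = (Finset.range n).image v := by
      intro v n
      ext x
      simp only [Finset.mem_image, Finset.mem_range]
      constructor
      · rintro ⟨j, hj, rfl⟩; exact ⟨n - 1 - j, by omega, rfl⟩
      · rintro ⟨j, hj, rfl⟩
        exact ⟨n - 1 - j, by omega, by rw [show n - 1 - (n - 1 - j) = j by omega]⟩
    have e1 := e w k
    have e2 := e u (k + 1)
    simp only [Nat.add_sub_cancel] at e2
    simp [prefixExchange, e1, e2]

end ExchangeGraph

/-! ### The algorithms and their clean-call counts -/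

section Algorithm

open TwoOracleAlg

variable {E : Type*} [Fintype E]

open Classical in
/-- The queries on which the clean and the dirty oracles differ. -/
noncomputable def wrongSets (M Md : Fin 2 → Matroid E) : Finset (Fin 2 × Finset E) :=
  Finset.univ.filter fun q => (Md q.1).Indep (q.2 : Set E) ∧ ¬ (M q.1).Indep (q.2 : Set E)

theorem card_wrongSets (M Md : Fin 2 → Matroid E) :
    (wrongSets M Md).card = eta M Md 0 + eta M Md 1 := by
  classical
  have h : ∀ i, eta M Md i = ((Finset.univ : Finset (Finset E)).filter fun F : Finset E =>
      (Md i).Indep (F : Set E) ∧ ¬ (M i).Indep (F : Set E)).card := by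
    intro i
    rw [eta, ← Set.ncard_coe_finset]
    simp
  rw [h, h, wrongSets, Finset.card_filter, Finset.card_filter, Finset.card_filter,
    ← Finset.univ_product_univ, Finset.sum_product, Fin.sum_univ_two]

theorem card_le_two_pow_ceil_logb : Fintype.card E ≤ 2 ^ ⌈Real.logb 2 (Fintype.card E)⌉₊ := by
  rcases Nat.eq_zero_or_pos (Fintype.card E) with h | h
  · exact h.le.trans (Nat.zero_le _)
  · have h1 : (Fintype.card E : ℝ) ≤ 2 ^ (⌈Real.logb 2 (Fintype.card E)⌉₊ : ℝ) :=
      (Real.logb_le_iff_le_rpow (by norm_num) (by exact_mod_cast h)).1 (Nat.le_ceil _)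
    rw [Real.rpow_natCast] at h1
    exact_mod_cast h1

/-- The outcome of an augmentation step at `X`. -/
def IsAugmentation (M : Fin 2 → Matroid E) (X : Finset E) (o : Option (Finset E)) : Prop :=
  (∃ Y : Finset E, o = some Y ∧ CommonIndep M Y ∧ Y.card = X.card + 1) ∨
    (o = none ∧ IsMaxCommonIndep M X)

/-- Augmentation when the dirty matroids are known, as well as a set `K` of wrong queries. -/
theorem exists_augmentation_of_wrong [DecidableEq E] (D : Fin 2 × Finset E → Prop) (X : Finset E)
    {L : ℕ} (hL : Fintype.card E ≤ 2 ^ L) (N : ℕ) :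
    ∀ K : Finset (Fin 2 × Finset E), Fintype.card (Fin 2 × Finset E) ≤ K.card + N →
    ∃ a : TwoOracleAlg E (Option (Finset E)), ∀ M Md : Fin 2 → Matroid E,
      (∀ q, D q ↔ (Md q.1).Indep (q.2 : Set E)) → IsInstance M Md → K ⊆ wrongSets M Md →
      CommonIndep M X → IsAugmentation M X (a.run M Md) ∧
        a.cleanCalls M Md ≤ 2 + ((wrongSets M Md).card - K.card) * (L + 2) := by
  classical
  induction N with
  | zero =>
    -- Here every query would be an error, including the clean-independent `X`, so no instance
    -- remains.
    intro K hK
    have hKu : K = Finset.univ := Finset.card_eq_iff_eq_univ K |>.1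
      (le_antisymm (Finset.card_le_univ K) hK)
    refine ⟨.output none, fun M Md _ hI hKw hX => ⟨Or.inr ⟨rfl, ?_⟩, by simp [cleanCalls]⟩⟩
    have := hKw (hKu ▸ Finset.mem_univ (0, X))
    simp only [wrongSets, Finset.mem_filter] at this
    exact absurd (hX 0) this.2.2
  | succ N ih =>
    intro K hK
    -- These families need not be matroids; only their containing the clean families matters.
    let J : Fin 2 → Finset E → Prop := fun i F => D (i, F) ∧ (i, F) ∉ K
    have hJ : ∀ M Md : Fin 2 → Matroid E, (∀ q, D q ↔ (Md q.1).Indep (q.2 : Set E)) →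
        IsInstance M Md → K ⊆ wrongSets M Md →
        ∀ i (F : Finset E), (M i).Indep (F : Set E) → J i F := by
      intro M Md hD hI hKw i F hF
      refine ⟨(hD (i, F)).2 (hI.superset i F hF), fun hm => ?_⟩
      have := hKw hm
      simp only [wrongSets, Finset.mem_filter] at this
      exact this.2.2 hF
    by_cases hpath : ∃ t y, ReachIn J X t y ∧ J 1 (insert y X)
    · obtain ⟨k, u, w, harc, hZ⟩ := exists_isArcSeq hpath
      -- A refuted arc set enlarges `K`, which frees `L + 2` calls of the bound: `L` for the binary
      -- search and 2 for testing the exchange.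
      have hnext : ∀ i m, ∃ a : TwoOracleAlg E (Option (Finset E)), m ≤ k →
          ∀ M Md : Fin 2 → Matroid E,
          (∀ q, D q ↔ (Md q.1).Indep (q.2 : Set E)) → IsInstance M Md → K ⊆ wrongSets M Md →
          CommonIndep M X → ¬ (M i).Indep (arcSet X (u i) (w i) m : Set E) →
          IsAugmentation M X (a.run M Md) ∧
            a.cleanCalls M Md + (L + 2) ≤ 2 + ((wrongSets M Md).card - K.card) * (L + 2) := by
        intro i m
        by_cases hm : m ≤ k
        · obtain ⟨hDm, hKm⟩ := (harc i).arc m hm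
          have hcard := Finset.card_insert_of_notMem hKm
          obtain ⟨a, ha⟩ := ih (insert (i, arcSet X (u i) (w i) m) K) (by omega)
          refine ⟨a, fun _ M Md hD hI hKw hX hind => ?_⟩
          have hsub : insert (i, arcSet X (u i) (w i) m) K ⊆ wrongSets M Md := by
            rw [Finset.insert_subset_iff]
            refine ⟨?_, hKw⟩
            simp only [wrongSets, Finset.mem_filter, Finset.mem_univ, true_and]
            exact ⟨(hD _).1 hDm, hind⟩
          obtain ⟨h1, h2⟩ := ha M Md hD hI hsub hX
          refine ⟨h1, ?_⟩
          have hle := Finset.card_le_card hsub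
          rw [hcard] at h2 hle
          obtain ⟨e, he⟩ := Nat.exists_eq_add_of_le hle
          rw [show (wrongSets M Md).card - (K.card + 1) = e by omega] at h2
          rw [show (wrongSets M Md).card - K.card = e + 1 by omega, add_mul]
          omega
        · exact ⟨.output none, fun h => absurd h hm⟩
      choose g hg using hnext
      have hlen : k + 1 ≤ 2 ^ L := (harc 0).length_le.trans hL
      choose b hb using fun i =>
        exists_binary_search i (prefixExchange X (u i) (w i)) (g i) L 0 (k + 1) hlen
      have hfail : ∀ i, ∀ M Md : Fin 2 → Matroid E,
          (∀ q, D q ↔ (Md q.1).Indep (q.2 : Set E)) → IsInstance M Md → K ⊆ wrongSets M Md →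
          CommonIndep M X → ¬ (M i).Indep (prefixExchange X (u 0) (w 0) (k + 1) : Set E) →
          IsAugmentation M X ((b i).run M Md) ∧
            (b i).cleanCalls M Md + 2 ≤ 2 + ((wrongSets M Md).card - K.card) * (L + 2) := by
        intro i M Md hD hI hKw hX hdep
        have hZi : prefixExchange X (u 0) (w 0) (k + 1) = prefixExchange X (u i) (w i) (k + 1) := by
          revert i
          rw [Fin.forall_fin_two]
          exact ⟨fun _ => rfl, fun _ => hZ⟩
        obtain ⟨m, _, hmk, h0, h1, hrun, hcalls⟩ := hb i M Md
          (by simpa [prefixExchange] using hX i) (by rwa [zero_add, ← hZi])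
        have hmk' : m ≤ k := by omega
        obtain ⟨h2, h3⟩ := hg i m hmk' M Md hD hI hKw hX
          ((harc i).not_indep_arcSet (hI.partition i) (hX i) (hJ M Md hD hI hKw i) hmk' h0 h1)
        exact ⟨hrun ▸ h2, by omega⟩
      refine ⟨.cleanQuery 0 (prefixExchange X (u 0) (w 0) (k + 1)) fun t =>
        if t then .cleanQuery 1 (prefixExchange X (u 0) (w 0) (k + 1)) fun t' =>
          if t' then .output (some (prefixExchange X (u 0) (w 0) (k + 1))) else b 1
        else b 0, fun M Md hD hI hKw hX => ?_⟩
      by_cases h0 : (M 0).Indep (prefixExchange X (u 0) (w 0) (k + 1) : Set E)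
      · by_cases h1 : (M 1).Indep (prefixExchange X (u 0) (w 0) (k + 1) : Set E)
        · simp only [run, cleanCalls, h0, h1, decide_true, if_true]
          refine ⟨Or.inl ⟨_, rfl, ?_, (harc 0).card_prefixExchange⟩, by omega⟩
          exact Fin.forall_fin_two.2 ⟨h0, h1⟩
        · obtain ⟨h2, h3⟩ := hfail 1 M Md hD hI hKw hX h1
          simp only [run, cleanCalls, h0, h1, decide_true, decide_false, if_true,
            Bool.false_eq_true, if_false]
          exact ⟨h2, by omega⟩
      · obtain ⟨h2, h3⟩ := hfail 0 M Md hD hI hKw hX h0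
        simp only [run, cleanCalls, h0, decide_false, Bool.false_eq_true, if_false]
        exact ⟨h2, by omega⟩
    · refine ⟨.output none, fun M Md hD hI hKw hX => ⟨Or.inr ⟨rfl, ?_⟩, by simp [cleanCalls]⟩⟩
      exact isMaxCommonIndep_of_not_reachIn hI.partition hX (hJ M Md hD hI hKw)
        fun t y ht hy => hpath ⟨t, y, ht, hy⟩

theorem exists_augmentation [DecidableEq E] (X : Finset E) :
    ∃ a : TwoOracleAlg E (Option (Finset E)), ∀ M Md : Fin 2 → Matroid E, IsInstance M Md →
      CommonIndep M X →
        IsAugmentation M X (a.run M Md) ∧ a.cleanCalls M Md ≤ stepBound M Md := by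
  refine exists_alg_of_forall_dirty (fun M Md o c => IsInstance M Md → CommonIndep M X →
    IsAugmentation M X o ∧ c ≤ stepBound M Md) fun D => ?_
  obtain ⟨a, ha⟩ := exists_augmentation_of_wrong D X card_le_two_pow_ceil_logb
    (Fintype.card (Fin 2 × Finset E)) ∅ (Nat.le_add_left _ _)
  refine ⟨a, fun M Md hD hI hX => ?_⟩
  simpa [stepBound, card_wrongSets] using ha M Md hD hI (Finset.empty_subset _) hX

theorem CommonIndep.card_le_minRank {M : Fin 2 → Matroid E} {X : Finset E}
    (hX : CommonIndep M X) : X.card ≤ minRank M := by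
  have h : ∀ i, X.card ≤ (M i).eRank.toNat := by
    intro i
    have h1 := (hX i).encard_le_eRank
    rw [Set.encard_coe_eq_coe_finsetCard] at h1
    have h2 : (M i).eRank ≠ ⊤ :=
      ((M i).eRank_le_encard_ground.trans_lt (Set.toFinite (M i).E).encard_lt_top).ne
    simpa using ENat.toNat_le_toNat h1 h2
  exact le_min (h 0) (h 1)

/-- Every success adds an element, so at most `minRank M - X.card` steps succeed and one more fails.
The fuel `N` keeps the tree finite independently of the matroids. -/
theorem exists_maximization_of_augmentation [DecidableEq E]
    (step : Finset E → TwoOracleAlg E (Option (Finset E)))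
    (hstep : ∀ X, ∀ M Md : Fin 2 → Matroid E, IsInstance M Md → CommonIndep M X →
      IsAugmentation M X ((step X).run M Md) ∧ (step X).cleanCalls M Md ≤ stepBound M Md) (N : ℕ) :
    ∀ X : Finset E, Fintype.card E < X.card + N → ∃ a : TwoOracleAlg E (Finset E),
      ∀ M Md : Fin 2 → Matroid E, IsInstance M Md → CommonIndep M X →
        IsMaxCommonIndep M (a.run M Md) ∧
          a.cleanCalls M Md ≤ (minRank M - X.card + 1) * stepBound M Md := by
  induction N with
  | zero => exact fun X hX => absurd (Finset.card_le_univ X) (by omega)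
  | succ N ih =>
    intro X hXN
    -- The tree needs a continuation for every conceivable output of `step X`; those of the wrong
    -- size get a dummy.
    have hnext : ∀ Y : Finset E, ∃ a : TwoOracleAlg E (Finset E), Y.card = X.card + 1 →
        ∀ M Md : Fin 2 → Matroid E, IsInstance M Md → CommonIndep M Y →
        IsMaxCommonIndep M (a.run M Md) ∧
          a.cleanCalls M Md ≤ (minRank M - Y.card + 1) * stepBound M Md := by
      intro Y
      by_cases hY : Y.card = X.card + 1
      · obtain ⟨a, ha⟩ := ih Y (by omega)
        exact ⟨a, fun _ => ha⟩
      · exact ⟨.output Y, fun h => absurd h hY⟩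
    choose g hg using hnext
    refine ⟨(step X).bind fun o => o.elim (.output X) g, fun M Md hI hX => ?_⟩
    rw [run_bind, cleanCalls_bind]
    obtain ⟨⟨Y, hrun, hY, hcard⟩ | ⟨hrun, hmax⟩, hcalls⟩ := hstep X M Md hI hX
    · obtain ⟨h1, h2⟩ := hg Y hcard M Md hI hY
      have hr := hY.card_le_minRank
      rw [hrun]
      refine ⟨h1, ?_⟩
      rw [show minRank M - X.card + 1 = (minRank M - Y.card + 1) + 1 by omega,
        Nat.succ_mul (minRank M - Y.card + 1), add_comm]
      exact Nat.add_le_add h2 hcalls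
    · rw [hrun]
      refine ⟨hmax, ?_⟩
      simp only [Option.elim, cleanCalls, add_zero]
      exact hcalls.trans (Nat.le_mul_of_pos_left _ (Nat.succ_pos _))

end Algorithm

theorem proposition4p2 {E : Type*} [Fintype E] [DecidableEq E] :
    (∃ step : Finset E → TwoOracleAlg E (Option (Finset E)),
      ∀ M Md : Fin 2 → Matroid E, IsInstance M Md →
        ∀ X : Finset E, CommonIndep M X →
          ((∃ Y : Finset E, (step X).run M Md = some Y ∧ CommonIndep M Y ∧
              Y.card = X.card + 1) ∨
            ((step X).run M Md = none ∧ IsMaxCommonIndep M X)) ∧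
          (step X).cleanCalls M Md ≤ stepBound M Md) ∧
    (∃ alg : TwoOracleAlg E (Finset E),
      ∀ M Md : Fin 2 → Matroid E, IsInstance M Md →
        IsMaxCommonIndep M (alg.run M Md) ∧
        alg.cleanCalls M Md ≤ (minRank M + 1) * stepBound M Md) := by
  choose step hstep using exists_augmentation (E := E)
  refine ⟨⟨step, fun M Md hI X hX => hstep X M Md hI hX⟩, ?_⟩
  obtain ⟨alg, halg⟩ := exists_maximization_of_augmentation step hstep (Fintype.card E + 1) ∅
    (by simp)
  refine ⟨alg, fun M Md hI => ?_⟩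
  simpa using halg M Md hI fun i => by simp
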